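/- **Setting.** Let $\Sigma$ be a finite alphabet and $\mathbb X$ a set of string variables; terms are words over $\mathbb X$. A multi-equation system $\Phi$ is a conjunction $\mathcal E\land\bigwedge_{x\in\mathbb X}x\in\mathsf{Lang}_\Phi(x)$, where $\mathcal E$ is a finite conjunction of pairwise different word equations $s=t$ between different terms ($s=t$ and $t=s$ are not distinguished) and each $\mathsf{Lang}_\Phi(x)\subseteq\Sigma^*$ is regular. A solution is a map $\nu:\mathbb X\to\Sigma^*$ with $\nu(s)=\nu(t)$ for every equation ($\nu$ extended to terms by concatenation) and $\nu(x)\in\mathsf{Lang}_\Phi(x)$ for every $x$; $\Phi$ is satisfiable if it has a solution. An inclusion graph of $\mathcal E$ is a directed graph $G=(V,E)$ whose vertices are inclusions $s\subseteq t$ with $s=t$ or $t=s$ in $\mathcal E$, such that: (1) for each equation $s=t$ at least one of $s\subseteq t$, $t\subseteq s$ is in $V$; (2) if $s\subseteq t$ is in $V$ and some variable of $t$ occurs more than once in the right-hand sides of all vertices of $V$, then $t\subseteq s$ is in $V$; (3) there is an edge from $s\subseteq t\in V$ to $s'\subseteq t'\in V$ iff $s$ and $t'$ share a variable; (4) if $s\subseteq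 t\in V$ lies on a cycle, then $t\subseteq s\in V$. An automata assignment $\mathsf{Aut}$ maps each variable to a nondeterministic finite automaton (NFA); for a term, $\mathsf{Aut}(x_1\cdots x_n)$ is the concatenation of the $\mathsf{Aut}(x_i)$, with an $\epsilon$-transition from each final state of $\mathsf{Aut}(x_i)$ to each initial state of $\mathsf{Aut}(x_{i+1})$ (for $n=0$, an automaton of the language $\{\epsilon\}$). The $\epsilon$-preserving product of two NFAs moves synchronously on letters, while on an $\epsilon$-transition of one automaton the other stays in its state. For $v=(s\subseteq t)$ with $s=x_1\cdots x_n$, $\mathtt{refine}(v,\mathsf{Aut})$ forms the $\epsilon$-preserving product $\Pi$ of $\mathsf{Aut}(s)$ with an $\epsilon$-free automaton equivalent to $\mathsf{Aut}(t)$ (obtained by any reduction method). For each tuple of $n-1$ $\epsilon$-transitions $q_i\to r_i$ ($1\le i<n$) that appear in this order in an accepting run of $\Pi$, it forms the noodle $\mathsf N(1),\dots,\mathsf N(n)$, where $\mathsf N(i)$ is $\Pi$ with initial state $r_{i-1}$ (for $i=1$: the initial states of $\Pi$) and final state $q_i$ (for $i=n$: the final states of $\Pi$), trimmed. It sets $\mathsf{Aut}'(x)$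 to the intersection of the $\mathsf N(j)$ with $x_j=x$ for each variable $x$ of $s$, and $\mathsf{Aut}'(x)=\mathsf{Aut}(x)$ for all other $x$, and returns the set of all $\mathsf{Aut}'$ so obtained for which the language of $\mathsf{Aut}'(s)$ is nonempty. $\mathtt{propagate}(G,\mathsf{Aut}_\Phi)$, where the automata $\mathsf{Aut}_\Phi(x)$ are $\epsilon$-free with languages $\mathsf{Lang}_\Phi(x)$, keeps a first-in first-out queue of pairs of an automata assignment and a first-in first-out queue of vertices, initially holding only $(\mathsf{Aut}_\Phi,V)$. While the queue is nonempty it dequeues a pair $(\mathsf{Aut},W)$ and returns $\mathtt{SAT}$ if $W=\emptyset$. Otherwise it dequeues a vertex $v=(s\subseteq t)$ from $W$. If the language of $\mathsf{Aut}(s)$ is included in that of $\mathsf{Aut}(t)$, it enqueues $(\mathsf{Aut},W)$. If not, it obtains $W'$ from $W$ by enqueuing all successors of $v$ in $G$ that are not in $W$, and enqueues $(\mathsf{Aut}',W')$ for every $\mathsf{Aut}'\in\mathtt{refine}(v,\mathsf{Aut})$. If the queue becomes empty, it returns $\mathtt{UNSAT}$. The orders in which $V$, the successors and the refinements are enqueued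 are arbitrary. **Theorem (Soundness).** Let $G$ be an inclusion graph of $\mathcal E$. 1. If $\mathsf{Lang}_\Phi(x)\neq\emptyset$ for all $x\in\mathbb X$ and $\mathtt{propagate}(G,\mathsf{Aut}_\Phi)$ returns $\mathtt{SAT}$, then $\Phi$ is satisfiable. 2. If $\mathtt{propagate}(G,\mathsf{Aut}_\Phi)$ returns $\mathtt{UNSAT}$, then $\Phi$ is unsatisfiable. -/

import Mathlib

namespace StringSolver

universe u v

/-! ### Finite automata with ε-transitions -/

/-- A nondeterministic finite automaton over `α`, possibly with ε-transitions (labelled `none`);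
its language is Mathlib's `εNFA.accepts`. -/
structure FinAut (α : Type u) where
  State : Type
  finite : Finite State
  aut : εNFA α State

namespace FinAut

variable {α : Type u}

/-- The language of the automaton. -/
def lang (A : FinAut α) : Language α := A.aut.accepts

/-- The automaton has no ε-transition. -/
def EpsFree (A : FinAut α) : Prop := ∀ q, A.aut.step q none = ∅

/-- The one-state automaton of the language `{ε}` (the concatenation of no automata). -/
def unit (α : Type u) : FinAut α where
  State := Unit
  finite := inferInstance
  aut :=
    { step := fun _ _ => ∅
      start := Set.univ
      accept := Set.univ }

/-- The ε-concatenation: the disjoint union of the two automata with an ε-transition from every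
final state of the first to every initial state of the second. -/
def concat (A B : FinAut α) : FinAut α where
  State := A.State ⊕ B.State
  finite := by
    have := A.finite
    have := B.finite
    infer_instance
  aut :=
    { step := fun p a => match p with
        | Sum.inl p => Sum.inl '' A.aut.step p a ∪
            {x | a = none ∧ p ∈ A.aut.accept ∧ ∃ q ∈ B.aut.start, x = Sum.inr q}
        | Sum.inr q => Sum.inr '' B.aut.step q a
      start := Sum.inl '' A.aut.start
      accept := Sum.inr '' B.aut.accept }

/-- The ε-preserving product. -/
def inter (A B : FinAut α) : FinAut α where
  State := A.State × B.State
  finite := by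
    have := A.finite
    have := B.finite
    infer_instance
  aut :=
    { step := fun p a => match a with
        | some b => {r | r.1 ∈ A.aut.step p.1 (some b) ∧ r.2 ∈ B.aut.step p.2 (some b)}
        | none => {r | (p.2 = r.2 ∧ r.1 ∈ A.aut.step p.1 none) ∨
            (p.1 = r.1 ∧ r.2 ∈ B.aut.step p.2 none)}
      start := {p | p.1 ∈ A.aut.start ∧ p.2 ∈ B.aut.start}
      accept := {p | p.1 ∈ A.aut.accept ∧ p.2 ∈ B.aut.accept} }

/-- The same transitions with new sets of initial and final states. -/
def withEnds (A : FinAut α) (I F : Set A.State) : FinAut α where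
  State := A.State
  finite := A.finite
  aut :=
    { step := A.aut.step
      start := I
      accept := F }

/-- The state belongs to some accepting run. -/
def Useful (A : FinAut α) (q : A.State) : Prop :=
  ∃ p ∈ A.aut.start, ∃ r ∈ A.aut.accept,
    (∃ w, A.aut.IsPath p q w) ∧ ∃ w, A.aut.IsPath q r w

/-- The restriction of the automaton to the states that belong to some accepting run. -/
def trim (A : FinAut α) : FinAut α where
  State := {q : A.State // A.Useful q}
  finite := by
    have := A.finite
    infer_instance
  aut :=
    { step := fun p a => {q | q.1 ∈ A.aut.step p.1 a}
      start := {q | q.1 ∈ A.aut.start}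
      accept := {q | q.1 ∈ A.aut.accept} }

/-- `B` is a possible outcome of removing the ε-transitions of `A` and then reducing the result by
some automata reduction method: an ε-free automaton with the same language. -/
def IsReductionOf (B A : FinAut α) : Prop := B.EpsFree ∧ B.lang = A.lang

/-- Some run from `p` to a final state takes the ε-transitions `q₁ → r₁, …, qₖ → rₖ` listed in
`es`, in that order. -/
def Threads (A : FinAut α) : A.State → List (A.State × A.State) → Prop
  | p, [] => ∃ f ∈ A.aut.accept, ∃ w, A.aut.IsPath p f w
  | p, (q, r) :: es =>
      (∃ w, A.aut.IsPath p q w) ∧ r ∈ A.aut.step q none ∧ Threads A r es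

/-- The noodle of the ε-transitions `q₁ → r₁, …, qₖ → rₖ`: the trimmed automata between `I` and
`{q₁}`, between `{r₁}` and `{q₂}`, …, between `{rₖ}` and the final states. -/
def noodle (A : FinAut α) : Set A.State → List (A.State × A.State) → List (FinAut α)
  | I, [] => [(A.withEnds I A.aut.accept).trim]
  | I, (q, r) :: es => (A.withEnds I {q}).trim :: noodle A {r} es

/-- The noodles of a product automaton for a term with `n` variable occurrences: one for each
`(n - 1)`-tuple of ε-transitions that appear, in that order, in an accepting run. -/
def noodlify (A : FinAut α) (n : ℕ) : Set (List (FinAut α)) :=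
  {N | ∃ es : List (A.State × A.State), es.length + 1 = n ∧
    (∃ p ∈ A.aut.start, A.Threads p es) ∧ N = A.noodle A.aut.start es}

end FinAut

/-! ### String constraints -/

/-- A string term: a word of variables. -/
abbrev Term (X : Type v) := List X

/-- The value of a term under a string assignment. -/
def termValue {α : Type u} {X : Type v} (ν : X → List α) (t : Term X) : List α := t.flatMap ν

/-- A multi-equation system: a finite conjunction of pairwise different word equations `s = t`
(not distinguished from `t = s`) between different terms, and one regular constraint for each
variable. -/
structure StringSystem (α : Type u) (X : Type v) where
  eqs : Finset (Sym2 (Term X))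
  different : ∀ e ∈ eqs, ¬ e.IsDiag
  lang : X → Language α
  regular : ∀ x, (lang x).IsRegular

namespace StringSystem

variable {α : Type u} {X : Type v}

/-- The string assignment satisfies all equations and all regular constraints. -/
def IsSolution (Φ : StringSystem α X) (ν : X → List α) : Prop :=
  (∀ s t : Term X, s(s, t) ∈ Φ.eqs → termValue ν s = termValue ν t) ∧ ∀ x, ν x ∈ Φ.lang x

def Satisfiable (Φ : StringSystem α X) : Prop := ∃ ν, Φ.IsSolution ν

/-- No variable is constrained to the empty language. -/
def Feasible (Φ : StringSystem α X) : Prop := ∀ x, ∃ w, w ∈ Φ.lang x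

end StringSystem

/-! ### Inclusion graphs -/

/-- The vertex `(s, t)` stands for the inclusion constraint `s ⊆ t`. -/
abbrev Vertex (X : Type v) := Term X × Term X

/-- A directed graph on inclusion constraints. -/
structure InclGraph (X : Type v) where
  verts : Finset (Vertex X)
  edge : Vertex X → Vertex X → Prop

open Classical in
/-- `G` is an inclusion graph of the given word equations. -/
structure InclGraph.IsInclusionGraphOf {X : Type v} (G : InclGraph X)
    (eqs : Finset (Sym2 (Term X))) : Prop where
  /-- every vertex is an orientation of an equation -/
  vertex_of_eq : ∀ s t : Term X, (s, t) ∈ G.verts → s(s, t) ∈ eqs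
  /-- every equation has at least one of its two orientations among the vertices -/
  at_least_one : ∀ s t : Term X, s(s, t) ∈ eqs → (s, t) ∈ G.verts ∨ (t, s) ∈ G.verts
  /-- a vertex whose right-hand side has a variable that occurs more than once in the right-hand
  sides of all vertices comes with its dual -/
  multi_occur : ∀ s t : Term X, (s, t) ∈ G.verts →
    (∃ x ∈ t, 2 ≤ ∑ v ∈ G.verts, v.2.count x) → (t, s) ∈ G.verts
  /-- the edges are the pairs of vertices whose left-hand and right-hand side, respectively, share
  a variable -/
  edges : ∀ v w : Vertex X,
    G.edge v w ↔ v ∈ G.verts ∧ w ∈ G.verts ∧ ∃ x, x ∈ v.1 ∧ x ∈ w.2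
  /-- a vertex on a cycle comes with its dual -/
  cycle : ∀ s t : Term X, (s, t) ∈ G.verts → Relation.TransGen G.edge (s, t) (s, t) →
    (t, s) ∈ G.verts

/-! ### Automata assignments and their refinement -/

/-- An assignment of automata to the variables. -/
abbrev AutAssign (α : Type u) (X : Type v) := X → FinAut α

namespace AutAssign

variable {α : Type u} {X : Type v}

/-- The assigned automata are ε-free and their languages are those of the given language
assignment. -/
def Represents (A : AutAssign α X) (L : X → Language α) : Prop :=
  ∀ x, (A x).EpsFree ∧ (A x).lang = L x

/-- The automaton of a term: the ε-concatenation of the automata of its variable occurrences. -/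
def ofTerm (A : AutAssign α X) : Term X → FinAut α
  | [] => FinAut.unit α
  | [x] => A x
  | x :: y :: t => (A x).concat (ofTerm A (y :: t))

open Classical in
/-- The automata assignment obtained from `A` and a noodle `N` for the term `s`: each variable of
`s` gets the intersection of the parts of the noodle at its occurrences in `s`, the other
variables keep their automata. -/
noncomputable def unify (A : AutAssign α X) (s : Term X) (N : List (FinAut α)) : AutAssign α X :=
  fun x =>
    match (s.zip N).filterMap (fun p => if p.1 = x then some p.2 else none) with
    | [] => A x
    | B :: Bs => Bs.foldl FinAut.inter B

/-- The set of refinements of `A` at the inclusion with left-hand side `s`, where `B` is the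
reduced automaton of the right-hand side. -/
def refinements (A : AutAssign α X) (s : Term X) (B : FinAut α) : Set (AutAssign α X) :=
  {A' | (∃ N ∈ ((A.ofTerm s).inter B).noodlify s.length, A' = A.unify s N) ∧
    ∃ w, w ∈ (A'.ofTerm s).lang}

/-- `T` is a possible outcome of the refinement of `A` at the vertex `v` (the outcome depends on
how the automaton of the right-hand side is reduced). -/
def RefineResult (A : AutAssign α X) (v : Vertex X) (T : Set (AutAssign α X)) : Prop :=
  ∃ B : FinAut α, B.IsReductionOf (A.ofTerm v.2) ∧ T = A.refinements v.1 B

end AutAssign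

/-! ### The algorithm -/

/-- The list enumerates the set without repetition. -/
def Enumerates {β : Type*} (l : List β) (S : Set β) : Prop := l.Nodup ∧ ∀ b, b ∈ l ↔ b ∈ S

/-- The queue of branches; a branch is an automata assignment with its queue of vertices. -/
abbrev Worklist (α : Type u) (X : Type v) := List (AutAssign α X × List (Vertex X))

/-- One iteration of the main loop that does not return. Both queues are first-in first-out: the
head is dequeued and new elements are enqueued at the end. The orders in which the two `foreach`
loops run through their sets are arbitrary. -/
inductive Step {α : Type u} {X : Type v} (G : InclGraph X) : Worklist α X → Worklist α X → Prop
  | skip (A : AutAssign α X) (v : Vertex X) (W : List (Vertex X)) (Q : Worklist α X)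
      (hincl : (A.ofTerm v.1).lang ≤ (A.ofTerm v.2).lang) :
      Step G ((A, v :: W) :: Q) (Q ++ [(A, W)])
  | branch (A : AutAssign α X) (v : Vertex X) (W : List (Vertex X)) (Q : Worklist α X)
      (hincl : ¬ (A.ofTerm v.1).lang ≤ (A.ofTerm v.2).lang)
      (R : Set (AutAssign α X)) (hR : A.RefineResult v R)
      (U : List (Vertex X)) (hU : Enumerates U {u | G.edge v u ∧ u ∉ W})
      (T : List (AutAssign α X)) (hT : Enumerates T R) :
      Step G ((A, v :: W) :: Q) (Q ++ T.map (fun A' => (A', W ++ U)))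

/-- The possible answers. -/
inductive Answer
  | sat
  | unsat

/-- `Propagate G A ans`: some execution of the algorithm on the inclusion graph `G` and the
initial automata assignment `A` returns `ans`. The order in which the vertices are initially
enqueued is arbitrary. -/
inductive Propagate {α : Type u} {X : Type v} (G : InclGraph X) (A : AutAssign α X) :
    Answer → Prop
  | sat (V : List (Vertex X)) (hV : Enumerates V (G.verts : Set (Vertex X)))
      (A' : AutAssign α X) (Q : Worklist α X)
      (h : Relation.ReflTransGen (Step G) [(A, V)] ((A', []) :: Q)) : Propagate G A Answer.sat
  | unsat (V : List (Vertex X)) (hV : Enumerates V (G.verts : Set (Vertex X)))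
      (h : Relation.ReflTransGen (Step G) [(A, V)] []) : Propagate G A Answer.unsat

end StringSolver

/-!
The languages of the automata of terms, products and noodles are computed through runs. Two facts
about a refinement at `s ⊆ t` carry the proof.

* No solution is lost (`AutAssign.exists_mem_refinements`): if `ν` solves `s = t`, the product of the
  automata of `s` and `t` has an accepting run on `ν(s)` that passes the concatenation ε-transitions
  where the values of the variable occurrences end, and the noodle of these transitions accepts the
  values of the variables. Hence a solution survives in some branch of the search, and the queue
  cannot become empty.
* Languages only shrink, and the inclusion `s ⊆ t` holds afterwards with respect to the old automata
  of `t` (`AutAssign.isRefinement_of_mem_refinements`). That `N(i)` is within the language of `xᵢ`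
  depends on ε-freeness of the assigned automata: the product is then arranged in one layer for each
  variable occurrence, and each ε-transition leads from one layer to the next
  (`FinAut.Layered.noodlify`). So an inclusion that is not queued always holds
  (`BranchInvariant.branch`), and with an empty queue all inclusions hold.

It remains to solve the equations when all inclusions of an inclusion graph hold and no language is
empty (`InclGraph.IsInclusionGraphOf.exists_solution`). If both orientations of an equation are
vertices, the two sides have the same language, and it is solved by giving each variable the
shortlex-least word of its language, since the value of a term is then the shortlex-least word of
the language of the term. If only `s ⊆ t` is a vertex, no variable of `t` occurs a second time on a
right-hand side, so any value of `s` can be matched by choosing the values of the variables of `t`.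
These vertices lie on no cycle; satisfying each after its successors never changes a left-hand side
already used, nor a variable of an equation of the first kind.
-/

namespace StringSolver

namespace FinAut

variable {α : Type*}

/-! ### Runs of automata -/

/-- `A.Run p q w`: some path of `A` from `p` to `q` reads the word `w`, ignoring ε-transitions. -/
inductive Run (A : FinAut α) : A.State → A.State → List α → Prop
  | nil (p : A.State) : Run A p p []
  | eps {p q r : A.State} {w : List α} (h : q ∈ A.aut.step p none) (hr : Run A q r w) : Run A p r w
  | letter {p q r : A.State} {a : α} {w : List α} (h : q ∈ A.aut.step p (some a))
      (hr : Run A q r w) : Run A p r (a :: w)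

variable {A B : FinAut α}

theorem Run.of_isPath {p q : A.State} {u : List (Option α)} (h : A.aut.IsPath p q u) :
    A.Run p q u.reduceOption := by
  induction h with
  | nil p => exact .nil p
  | cons q p r a u h _ ih =>
    cases a with
    | none => rw [List.reduceOption_cons_of_none]; exact .eps h ih
    | some a => rw [List.reduceOption_cons_of_some]; exact .letter h ih

theorem Run.exists_isPath {p q : A.State} {w : List α} (h : A.Run p q w) :
    ∃ u, u.reduceOption = w ∧ A.aut.IsPath p q u := by
  induction h with
  | nil p => exact ⟨[], rfl, .nil p⟩
  | eps h _ ih =>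
    obtain ⟨u, hu, hp⟩ := ih
    exact ⟨none :: u, by rw [List.reduceOption_cons_of_none, hu], .cons _ _ _ _ _ h hp⟩
  | @letter _ _ _ a _ h _ ih =>
    obtain ⟨u, hu, hp⟩ := ih
    exact ⟨some a :: u, by rw [List.reduceOption_cons_of_some, hu], .cons _ _ _ _ _ h hp⟩

theorem exists_isPath_iff {p q : A.State} : (∃ u, A.aut.IsPath p q u) ↔ ∃ w, A.Run p q w :=
  ⟨fun ⟨_, hu⟩ => ⟨_, .of_isPath hu⟩, fun ⟨_, hw⟩ => let ⟨u, _, hu⟩ := hw.exists_isPath; ⟨u, hu⟩⟩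

theorem mem_lang {w : List α} :
    w ∈ A.lang ↔ ∃ p ∈ A.aut.start, ∃ q ∈ A.aut.accept, A.Run p q w := by
  rw [lang, εNFA.mem_accepts_iff_exists_path]
  constructor
  · rintro ⟨p, q, u, hp, hq, rfl, h⟩
    exact ⟨p, hp, q, hq, .of_isPath h⟩
  · rintro ⟨p, hp, q, hq, h⟩
    obtain ⟨u, hu, h⟩ := h.exists_isPath
    exact ⟨p, q, u, hp, hq, hu, h⟩

theorem Run.trans {p q r : A.State} {u w : List α} (h : A.Run p q u) (h' : A.Run q r w) :
    A.Run p r (u ++ w) := by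
  induction h with
  | nil p => exact h'
  | eps h _ ih => exact .eps h (ih h')
  | letter h _ ih => exact .letter h (ih h')

theorem Run.exists_of_cons {p r : A.State} {a : α} {w : List α} (h : A.Run p r (a :: w)) :
    ∃ q q', A.Run p q [] ∧ q' ∈ A.aut.step q (some a) ∧ A.Run q' r w := by
  generalize hu : a :: w = u at h
  induction h with
  | nil p => cases hu
  | eps h _ ih =>
    obtain ⟨q, q', h1, h2, h3⟩ := ih hu
    exact ⟨q, q', .eps h h1, h2, h3⟩
  | letter h hr ih =>
    cases hu
    exact ⟨_, _, .nil _, h, hr⟩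

theorem Run.exists_of_append {p r : A.State} {u w : List α} (h : A.Run p r (u ++ w)) :
    ∃ q, A.Run p q u ∧ A.Run q r w := by
  induction u generalizing p with
  | nil => exact ⟨p, .nil p, h⟩
  | cons a u ih =>
    obtain ⟨q, q', h1, h2, h3⟩ := h.exists_of_cons
    obtain ⟨m, h4, h5⟩ := ih h3
    exact ⟨m, h1.trans (.letter h2 h4), h5⟩

/-- A map of states that respects the transitions sends runs to runs. -/
theorem Run.map (f : A.State → B.State)
    (hf : ∀ p q a, q ∈ A.aut.step p a → f q ∈ B.aut.step (f p) a)
    {p q : A.State} {w : List α} (h : A.Run p q w) : B.Run (f p) (f q) w := by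
  induction h with
  | nil p => exact .nil _
  | eps h _ ih => exact .eps (hf _ _ _ h) ih
  | letter h _ ih => exact .letter (hf _ _ _ h) ih

/-! ### Languages of the constructions on automata -/

theorem mem_lang_unit {w : List α} : w ∈ (unit α).lang ↔ w = [] := by
  rw [mem_lang]
  constructor
  · rintro ⟨p, -, q, -, h⟩
    cases h with
    | nil => rfl
    | eps h => cases h
    | letter h => cases h
  · rintro rfl
    exact ⟨(), trivial, (), trivial, .nil _⟩

theorem Run.concat_inl {p q : A.State} {w : List α} (h : A.Run p q w) :
    (A.concat B).Run (Sum.inl p) (Sum.inl q) w :=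
  h.map (B := A.concat B) Sum.inl fun _ q _ hq => Or.inl ⟨q, hq, rfl⟩

theorem Run.concat_inr {p q : B.State} {w : List α} (h : B.Run p q w) :
    (A.concat B).Run (Sum.inr p) (Sum.inr q) w :=
  h.map (B := A.concat B) Sum.inr fun _ q _ hq => ⟨q, hq, rfl⟩

theorem inr_mem_concat_step {p : A.State} {q : B.State} (hp : p ∈ A.aut.accept)
    (hq : q ∈ B.aut.start) : Sum.inr q ∈ (A.concat B).aut.step (Sum.inl p) none :=
  Or.inr ⟨rfl, hp, q, hq, rfl⟩

theorem run_concat_inr_iff {p : B.State} {x : (A.concat B).State} {w : List α} :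
    (A.concat B).Run (Sum.inr p) x w ↔ ∃ q, x = Sum.inr q ∧ B.Run p q w := by
  refine ⟨fun h => ?_, fun ⟨q, hx, h⟩ => hx ▸ h.concat_inr⟩
  obtain ⟨y, hy⟩ : ∃ y : (A.concat B).State, y = Sum.inr p := ⟨_, rfl⟩
  rw [← hy] at h
  induction h generalizing p with
  | nil => exact ⟨p, hy, .nil p⟩
  | eps h _ ih =>
    subst hy
    obtain ⟨p', hp', rfl⟩ := h
    obtain ⟨q, hq, hr⟩ := ih rfl
    exact ⟨q, hq, .eps hp' hr⟩
  | letter h _ ih =>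
    subst hy
    obtain ⟨p', hp', rfl⟩ := h
    obtain ⟨q, hq, hr⟩ := ih rfl
    exact ⟨q, hq, .letter hp' hr⟩

theorem run_concat_inl {p : A.State} {x : (A.concat B).State} {w : List α}
    (h : (A.concat B).Run (Sum.inl p) x w) :
    (∃ q, x = Sum.inl q ∧ A.Run p q w) ∨
      ∃ q ∈ A.aut.accept, ∃ r ∈ B.aut.start, ∃ r', x = Sum.inr r' ∧
        ∃ u u', u ++ u' = w ∧ A.Run p q u ∧ B.Run r r' u' := by
  obtain ⟨y, hy⟩ : ∃ y : (A.concat B).State, y = Sum.inl p := ⟨_, rfl⟩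
  rw [← hy] at h
  induction h generalizing p with
  | nil => exact .inl ⟨p, hy, .nil p⟩
  | eps h hr ih =>
    subst hy
    obtain ⟨p', hp', rfl⟩ | ⟨-, hp, r, hrs, rfl⟩ := h
    · obtain ⟨q, hq, hr⟩ | ⟨q, hq, r, hrs, r', hr', u, u', hu, h1, h2⟩ := ih rfl
      · exact .inl ⟨q, hq, .eps hp' hr⟩
      · exact .inr ⟨q, hq, r, hrs, r', hr', u, u', hu, .eps hp' h1, h2⟩
    · obtain ⟨r', hr', hr⟩ := run_concat_inr_iff.1 hr
      exact .inr ⟨p, hp, r, hrs, r', hr', [], _, rfl, .nil p, hr⟩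
  | @letter _ _ _ a _ h hr ih =>
    subst hy
    obtain ⟨p', hp', rfl⟩ | ⟨hn, -⟩ := h
    · obtain ⟨q, hq, hr⟩ | ⟨q, hq, r, hrs, r', hr', u, u', hu, h1, h2⟩ := ih rfl
      · exact .inl ⟨q, hq, .letter hp' hr⟩
      · exact .inr ⟨q, hq, r, hrs, r', hr', a :: u, u', by rw [← hu]; rfl, .letter hp' h1, h2⟩
    · cases hn

theorem mem_lang_concat {w : List α} :
    w ∈ (A.concat B).lang ↔ ∃ u ∈ A.lang, ∃ u' ∈ B.lang, u ++ u' = w := by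
  simp only [mem_lang]
  constructor
  · rintro ⟨_, ⟨p, hp, rfl⟩, _, ⟨q, hq, rfl⟩, h⟩
    obtain ⟨_, hx, _⟩ | ⟨q', hq', r, hr, r', hr', u, u', hu, h1, h2⟩ := run_concat_inl h
    · cases hx
    · cases hr'
      exact ⟨u, ⟨p, hp, q', hq', h1⟩, u', ⟨r, hr, q, hq, h2⟩, hu⟩
  · rintro ⟨u, ⟨p, hp, q, hq, h⟩, u', ⟨p', hp', q', hq', h'⟩, rfl⟩
    exact ⟨Sum.inl p, ⟨p, hp, rfl⟩, Sum.inr q', ⟨q', hq', rfl⟩,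
      h.concat_inl.trans (.eps (inr_mem_concat_step hq hp') h'.concat_inr)⟩

theorem inter_step_left {p q : A.State} (h : q ∈ A.aut.step p none) (r : B.State) :
    ((q, r) : (A.inter B).State) ∈ (A.inter B).aut.step (p, r) none :=
  Or.inl ⟨rfl, h⟩

theorem inter_step_right {p q : B.State} (h : q ∈ B.aut.step p none) (r : A.State) :
    ((r, q) : (A.inter B).State) ∈ (A.inter B).aut.step (r, p) none :=
  Or.inr ⟨rfl, h⟩

theorem Run.inter {p q : A.State} {p' q' : B.State} {w : List α} (h : A.Run p q w)
    (h' : B.Run p' q' w) : (A.inter B).Run (p, p') (q, q') w := by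
  induction h generalizing p' with
  | nil p =>
    generalize hw : ([] : List α) = w at h'
    induction h' with
    | nil => exact .nil _
    | eps h _ ih => exact .eps (inter_step_right h _) (ih hw)
    | letter => cases hw
  | eps h _ ih => exact .eps (inter_step_left h _) (ih h')
  | letter h _ ih =>
    obtain ⟨m, m', h1, h2, h3⟩ := h'.exists_of_cons
    have hr : (A.inter B).Run _ _ _ := .letter (p := (_, m)) (q := (_, m')) ⟨h, h2⟩ (ih h3)
    clear h h' h2 h3 ih
    generalize hw : ([] : List α) = w at h1
    induction h1 with
    | nil => exact hr
    | eps h _ ih => exact .eps (inter_step_right h _) (ih hr hw)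
    | letter => cases hw

theorem Run.of_inter {x y : (A.inter B).State} {w : List α} (h : (A.inter B).Run x y w) :
    A.Run x.1 y.1 w ∧ B.Run x.2 y.2 w := by
  induction h with
  | nil => exact ⟨.nil _, .nil _⟩
  | eps h _ ih =>
    obtain ⟨h1, h2⟩ | ⟨h1, h2⟩ := h
    · exact ⟨.eps h2 ih.1, h1 ▸ ih.2⟩
    · exact ⟨h1 ▸ ih.1, .eps h2 ih.2⟩
  | letter h _ ih => exact ⟨.letter h.1 ih.1, .letter h.2 ih.2⟩

theorem mem_lang_inter {w : List α} : w ∈ (A.inter B).lang ↔ w ∈ A.lang ∧ w ∈ B.lang := by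
  simp only [mem_lang]
  constructor
  · rintro ⟨x, hx, y, hy, h⟩
    exact ⟨⟨x.1, hx.1, y.1, hy.1, h.of_inter.1⟩, ⟨x.2, hx.2, y.2, hy.2, h.of_inter.2⟩⟩
  · rintro ⟨⟨p, hp, q, hq, h⟩, ⟨p', hp', q', hq', h'⟩⟩
    exact ⟨(p, p'), ⟨hp, hp'⟩, (q, q'), ⟨hq, hq'⟩, h.inter h'⟩

theorem EpsFree.inter (hA : A.EpsFree) (hB : B.EpsFree) : (A.inter B).EpsFree := by
  intro x
  refine Set.eq_empty_iff_forall_notMem.2 fun y hy => ?_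
  obtain ⟨-, h⟩ | ⟨-, h⟩ := hy
  · rw [hA] at h; exact h
  · rw [hB] at h; exact h

theorem mem_lang_foldl_inter {w : List α} (L : List (FinAut α)) :
    w ∈ (L.foldl FinAut.inter B).lang ↔ ∀ C ∈ B :: L, w ∈ C.lang := by
  induction L generalizing B with
  | nil => simp
  | cons C L ih =>
    rw [List.foldl_cons, ih]
    simp only [List.forall_mem_cons, mem_lang_inter, and_assoc]

theorem EpsFree.foldl_inter {L : List (FinAut α)} (h : ∀ C ∈ B :: L, C.EpsFree) :
    (L.foldl FinAut.inter B).EpsFree := by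
  induction L generalizing B with
  | nil => exact h B List.mem_cons_self
  | cons C L ih =>
    simp only [List.forall_mem_cons] at h
    exact ih (List.forall_mem_cons.2 ⟨h.1.inter h.2.1, h.2.2⟩)

theorem useful_iff {q : A.State} :
    A.Useful q ↔ ∃ p ∈ A.aut.start, ∃ r ∈ A.aut.accept, (∃ w, A.Run p q w) ∧ ∃ w, A.Run q r w := by
  simp only [Useful, exists_isPath_iff]

theorem Run.trim {p q : A.State} {w : List α} (h : A.Run p q w)
    (hp : ∃ s ∈ A.aut.start, ∃ u, A.Run s p u) (hq : ∃ f ∈ A.aut.accept, ∃ u, A.Run q f u) :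
    ∃ hp' hq', A.trim.Run ⟨p, hp'⟩ ⟨q, hq'⟩ w := by
  obtain ⟨s, hs, u, hu⟩ := hp
  induction h generalizing u with
  | nil p =>
    obtain ⟨f, hf, v, hv⟩ := hq
    have : A.Useful p := useful_iff.2 ⟨s, hs, f, hf, ⟨u, hu⟩, v, hv⟩
    exact ⟨this, this, .nil _⟩
  | eps h hr ih =>
    obtain ⟨_, hq', hr'⟩ := ih hq _ (hu.trans (.eps h (.nil _)))
    obtain ⟨f, hf, v, hv⟩ := hq
    exact ⟨useful_iff.2 ⟨s, hs, f, hf, ⟨u, hu⟩, _, .eps h (hr.trans hv)⟩, hq',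
      .eps (A := A.trim) (p := ⟨_, _⟩) h hr'⟩
  | letter h hr ih =>
    obtain ⟨_, hq', hr'⟩ := ih hq _ (hu.trans (.letter h (.nil _)))
    obtain ⟨f, hf, v, hv⟩ := hq
    exact ⟨useful_iff.2 ⟨s, hs, f, hf, ⟨u, hu⟩, _, .letter h (hr.trans hv)⟩, hq',
      .letter (A := A.trim) (p := ⟨_, _⟩) h hr'⟩

theorem mem_lang_trim {w : List α} : w ∈ A.trim.lang ↔ w ∈ A.lang := by
  simp only [mem_lang]
  constructor
  · rintro ⟨p, hp, q, hq, h⟩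
    exact ⟨p.1, hp, q.1, hq, h.map (B := A) Subtype.val fun _ _ _ h => h⟩
  · rintro ⟨p, hp, q, hq, h⟩
    obtain ⟨hp', hq', h⟩ := h.trim ⟨p, hp, [], .nil p⟩ ⟨q, hq, [], .nil q⟩
    exact ⟨⟨p, hp'⟩, hp, ⟨q, hq'⟩, hq, h⟩

theorem run_withEnds {I F : Set A.State} {p q : A.State} {w : List α} :
    (A.withEnds I F).Run p q w ↔ A.Run p q w :=
  ⟨fun h => h.map (A := A.withEnds I F) (B := A) id fun _ _ _ h => h,
    fun h => Run.map (A := A) (B := A.withEnds I F) (p := p) (q := q) id (fun _ _ _ h => h) h⟩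

theorem mem_lang_trim_withEnds {I F : Set A.State} {w : List α} :
    w ∈ (A.withEnds I F).trim.lang ↔ ∃ p ∈ I, ∃ q ∈ F, A.Run p q w := by
  rw [mem_lang_trim, mem_lang]
  exact exists_congr fun p => and_congr_right fun _ => exists_congr fun q =>
    and_congr_right fun _ => run_withEnds

/-! ### Noodles -/

/-- `A.SplitRun p [w₁, …, wₙ]`: some run of `A` from `p` to a final state reads `w₁, …, wₙ`, with an
ε-transition singled out between any two consecutive words. -/
inductive SplitRun (A : FinAut α) : A.State → List (List α) → Prop
  | last {p q : A.State} {w : List α} (h : A.Run p q w) (hq : q ∈ A.aut.accept) : SplitRun A p [w]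
  | cons {p q r : A.State} {w : List α} {ws : List (List α)} (h : A.Run p q w)
      (hr : r ∈ A.aut.step q none) (hs : SplitRun A r ws) : SplitRun A p (w :: ws)

theorem SplitRun.exists_noodle {p : A.State} {ws : List (List α)} (h : A.SplitRun p ws)
    {I : Set A.State} (hp : p ∈ I) :
    ∃ es, es.length + 1 = ws.length ∧ A.Threads p es ∧
      List.Forall₂ (fun w N => w ∈ lang N) ws (A.noodle I es) := by
  induction h generalizing I with
  | last h hq =>
    exact ⟨[], rfl, ⟨_, hq, exists_isPath_iff.2 ⟨_, h⟩⟩,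
      .cons (mem_lang_trim_withEnds.2 ⟨_, hp, _, hq, h⟩) .nil⟩
  | @cons _ q r _ _ h hr hs ih =>
    obtain ⟨es, hl, ht, hN⟩ := ih (I := {r}) rfl
    exact ⟨(q, r) :: es, congrArg Nat.succ hl, ⟨exists_isPath_iff.2 ⟨_, h⟩, hr, ht⟩,
      .cons (mem_lang_trim_withEnds.2 ⟨_, hp, _, rfl, h⟩) hN⟩

theorem Threads.exists_run_flatten {p : A.State} {es : List (A.State × A.State)}
    (h : A.Threads p es) {I : Set A.State} {ws : List (List α)}
    (hN : List.Forall₂ (fun w N => w ∈ lang N) ws (A.noodle I es)) :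
    ∃ p' ∈ I, ∃ f ∈ A.aut.accept, A.Run p' f ws.flatten := by
  induction es generalizing p I ws with
  | nil =>
    obtain ⟨w, _, hw, h', rfl⟩ := List.forall₂_cons_right_iff.1 hN
    cases h'
    simpa using mem_lang_trim_withEnds.1 hw
  | cons e es ih =>
    obtain ⟨q, r⟩ := e
    obtain ⟨-, hr, ht⟩ := h
    obtain ⟨w, ws, hw, h', rfl⟩ := List.forall₂_cons_right_iff.1 hN
    obtain ⟨p', hp', _, rfl, h1⟩ := mem_lang_trim_withEnds.1 hw
    obtain ⟨_, rfl, f, hf, h2⟩ := ih ht h'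
    exact ⟨p', hp', f, hf, h1.trans (.eps hr h2)⟩

theorem noodlify_length {n : ℕ} {N : List (FinAut α)} (hN : N ∈ A.noodlify n) : N.length = n := by
  obtain ⟨es, hl, -, rfl⟩ := hN
  rw [← hl]
  clear hl
  generalize A.aut.start = I
  induction es generalizing I with
  | nil => rfl
  | cons e es ih => exact congrArg Nat.succ (ih {e.2})

theorem flatten_mem_lang_of_noodlify {n : ℕ} {N : List (FinAut α)} (hN : N ∈ A.noodlify n)
    {ws : List (List α)} (hw : List.Forall₂ (fun w N => w ∈ lang N) ws N) :
    ws.flatten ∈ A.lang := by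
  obtain ⟨es, -, ⟨p, -, ht⟩, rfl⟩ := hN
  exact mem_lang.2 (ht.exists_run_flatten hw)

theorem SplitRun.exists_mem_noodlify {p : A.State} {ws : List (List α)} (h : A.SplitRun p ws)
    (hp : p ∈ A.aut.start) :
    ∃ N ∈ A.noodlify ws.length, List.Forall₂ (fun w N => w ∈ lang N) ws N := by
  obtain ⟨es, hl, ht, hN⟩ := h.exists_noodle hp
  exact ⟨_, ⟨es, hl, ⟨p, hp, ht⟩, rfl⟩, hN⟩

theorem SplitRun.concat_inr {q : B.State} {ws : List (List α)} (h : B.SplitRun q ws) :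
    (A.concat B).SplitRun (Sum.inr q) ws := by
  induction h with
  | last h hq => exact .last h.concat_inr ⟨_, hq, rfl⟩
  | @cons _ _ r _ _ h hr _ ih => exact .cons h.concat_inr ⟨r, hr, rfl⟩ ih

theorem SplitRun.inter {p : A.State} {ws : List (List α)} (h : A.SplitRun p ws)
    {q f : B.State} (hf : f ∈ B.aut.accept) (hB : B.Run q f ws.flatten) :
    (A.inter B).SplitRun (p, q) ws := by
  induction h generalizing q with
  | last h hq =>
    rw [List.flatten_singleton] at hB
    exact .last (h.inter hB) ⟨hq, hf⟩
  | cons h hr _ ih =>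
    rw [List.flatten_cons] at hB
    obtain ⟨m, h1, h2⟩ := hB.exists_of_append
    exact .cons (h.inter h1) (inter_step_left hr m) (ih h2)

/-! ### Layered automata -/

/-- `A.Layered lev Ls`: the states of `A` are arranged in `Ls.length` consecutive layers, the
initial ones in the first and the final ones in the last. Letters stay within the layer and
ε-transitions lead to the next one, and the words read within layer `i`, between a state where runs
enter the layer and one where they leave it, belong to the `i`-th language of `Ls`. An
ε-concatenation of ε-free automata has this shape. -/
structure Layered (A : FinAut α) (lev : A.State → ℕ) (Ls : List (Language α)) : Prop where
  start : ∀ p ∈ A.aut.start, lev p = 0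
  accept : ∀ p ∈ A.aut.accept, lev p + 1 = Ls.length
  letter : ∀ p q a, q ∈ A.aut.step p (some a) → lev q = lev p
  eps : ∀ p q, q ∈ A.aut.step p none → lev q = lev p + 1
  mem : ∀ (i : ℕ) (hi : i < Ls.length) (p q : A.State) (w : List α), lev p = i → lev q = i →
    (p ∈ A.aut.start ∨ ∃ p', p ∈ A.aut.step p' none) →
    (q ∈ A.aut.accept ∨ ∃ q', q' ∈ A.aut.step q none) → A.Run p q w → w ∈ Ls[i]

theorem layered_singleton (hA : A.EpsFree) : A.Layered (fun _ => 0) [A.lang] where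
  start _ _ := rfl
  accept _ _ := rfl
  letter _ _ _ _ := rfl
  eps p q h := by rw [hA] at h; exact h.elim
  mem := by
    rintro i hi p q w rfl - hp hq h
    simp only [EpsFree] at hA
    simp only [hA, Set.mem_empty_iff_false, exists_false, or_false] at hp hq
    exact mem_lang.2 ⟨p, hp, q, hq, h⟩

theorem Layered.concat (hA : A.EpsFree) {lev : B.State → ℕ} {Ls : List (Language α)}
    (hB : B.Layered lev Ls) :
    (A.concat B).Layered (Sum.elim (fun _ => 0) fun q => lev q + 1) (A.lang :: Ls) where
  start := by
    rintro _ ⟨p, -, rfl⟩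
    rfl
  accept := by
    rintro _ ⟨p, hp, rfl⟩
    exact congrArg Nat.succ (hB.accept p hp)
  letter := by
    rintro (p | p) q a h
    · obtain ⟨q, -, rfl⟩ | ⟨h, -⟩ := h
      · rfl
      · cases h
    · obtain ⟨q, h, rfl⟩ := h
      exact congrArg Nat.succ (hB.letter _ _ _ h)
  eps := by
    rintro (p | p) q h
    · obtain ⟨q, h, rfl⟩ | ⟨-, -, q, hq, rfl⟩ := h
      · rw [hA] at h; exact h.elim
      · exact congrArg Nat.succ (hB.start q hq)
    · obtain ⟨q, h, rfl⟩ := h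
      exact congrArg Nat.succ (hB.eps _ _ h)
  mem := by
    rintro i hi (p | p) (q | q) w hp hq hp' hq' h
    · subst hp
      have hps : p ∈ A.aut.start := by
        rcases hp' with ⟨_, h, h'⟩ | ⟨p' | p', h⟩
        · cases h'; exact h
        · obtain ⟨_, h, h'⟩ | ⟨-, -, _, -, h⟩ := h
          · rw [hA] at h; exact h.elim
          · cases h
        · obtain ⟨_, _, h⟩ := h
          cases h
      have hqa : q ∈ A.aut.accept := by
        rcases hq' with ⟨_, _, h⟩ | ⟨q', h⟩
        · cases h
        · obtain ⟨_, h, -⟩ | ⟨-, h, -⟩ := h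
          · rw [hA] at h; exact h.elim
          · exact h
      obtain ⟨_, h', hr⟩ | ⟨_, _, _, _, _, h', _⟩ := run_concat_inl h
      · cases h'
        exact mem_lang.2 ⟨p, hps, q, hqa, hr⟩
      · cases h'
    · subst hp; cases hq
    · subst hq; cases hp
    · subst hp
      obtain ⟨_, h', hr⟩ := run_concat_inr_iff.1 h
      cases h'
      refine hB.mem _ (Nat.lt_of_succ_lt_succ hi) p q w rfl (Nat.succ.inj hq) ?_ ?_ hr
      · rcases hp' with ⟨_, _, h⟩ | ⟨p' | p', h⟩
        · cases h
        · obtain ⟨_, _, h⟩ | ⟨-, -, _, h, h'⟩ := h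
          · cases h
          · cases h'; exact .inl h
        · obtain ⟨_, h, h'⟩ := h
          cases h'; exact .inr ⟨_, h⟩
      · rcases hq' with ⟨_, h, h'⟩ | ⟨q', h⟩
        · cases h'; exact .inl h
        · obtain ⟨_, h, -⟩ := h
          exact .inr ⟨_, h⟩

theorem Layered.inter {lev : A.State → ℕ} {Ls : List (Language α)} (hA : A.Layered lev Ls)
    (hB : B.EpsFree) : (A.inter B).Layered (fun x => lev x.1) Ls := by
  have key : ∀ x y : (A.inter B).State, y ∈ (A.inter B).aut.step x none →
      y.1 ∈ A.aut.step x.1 none := by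
    rintro x y (⟨-, h⟩ | ⟨-, h⟩)
    · exact h
    · rw [hB] at h; exact h.elim
  exact
  { start := fun p hp => hA.start _ hp.1
    accept := fun p hp => hA.accept _ hp.1
    letter := fun p q a h => hA.letter _ _ _ h.1
    eps := fun p q h => hA.eps _ _ (key p q h)
    mem := fun i hi p q w hp hq hp' hq' h =>
      hA.mem i hi p.1 q.1 w hp hq (hp'.imp And.left fun ⟨p', h⟩ => ⟨p'.1, key _ _ h⟩)
        (hq'.imp And.left fun ⟨q', h⟩ => ⟨q'.1, key _ _ h⟩) h.of_inter.1 }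

section

variable {lev : A.State → ℕ} {Ls : List (Language α)}

theorem Layered.le_of_run (hA : A.Layered lev Ls) {p q : A.State} {w : List α}
    (h : A.Run p q w) : lev p ≤ lev q := by
  induction h with
  | nil => exact le_rfl
  | eps h _ ih => exact (Nat.le_succ _).trans ((hA.eps _ _ h).symm.trans_le ih)
  | letter h _ ih => exact (hA.letter _ _ _ h).symm.trans_le ih

theorem Layered.lev_add_length_lt (hA : A.Layered lev Ls) {p : A.State}
    {es : List (A.State × A.State)} (h : A.Threads p es) : lev p + es.length < Ls.length := by
  induction es generalizing p with
  | nil =>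
    obtain ⟨f, hf, h⟩ := h
    obtain ⟨w, h⟩ := exists_isPath_iff.1 h
    exact (hA.accept f hf) ▸ Nat.lt_succ_of_le (hA.le_of_run h)
  | cons e es ih =>
    obtain ⟨q, r⟩ := e
    obtain ⟨h, hr, ht⟩ := h
    obtain ⟨w, h⟩ := exists_isPath_iff.1 h
    have := hA.le_of_run h
    have := hA.eps _ _ hr
    have := ih ht
    simp only [List.length_cons]
    omega

/-- Within a single layer there is no ε-transition. -/
theorem Layered.epsFree_trim (hA : A.Layered lev Ls) {i : ℕ} {I F : Set A.State}
    (hI : ∀ p ∈ I, lev p = i) (hF : ∀ q ∈ F, lev q = i) : (A.withEnds I F).trim.EpsFree := by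
  have key : ∀ q, (A.withEnds I F).Useful q → lev q = i := by
    intro q hq
    obtain ⟨p, hp, r, hr, ⟨w, hw⟩, w', hw'⟩ := useful_iff.1 hq
    exact le_antisymm ((hA.le_of_run (run_withEnds.1 hw')).trans_eq (hF r hr))
      ((hI p hp).symm.trans_le (hA.le_of_run (run_withEnds.1 hw)))
  intro p
  refine Set.eq_empty_iff_forall_notMem.2 fun q hq => ?_
  have := hA.eps _ _ hq
  rw [key _ p.2, key _ q.2] at this
  omega

/-- When every ε-transition leads to the next layer, a run with one ε-transition fewer than there
are layers takes exactly the listed ones; so each part of the noodle lies within one layer. -/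
theorem Layered.noodle (hA : A.Layered lev Ls) {p : A.State} {es : List (A.State × A.State)}
    (h : A.Threads p es) {I : Set A.State} (hp : p ∈ I) {i : ℕ}
    (hI : ∀ q ∈ I, lev q = i ∧ (q ∈ A.aut.start ∨ ∃ q', q ∈ A.aut.step q' none))
    (hl : i + es.length + 1 = Ls.length) :
    List.Forall₂ (fun N L => EpsFree N ∧ lang N ≤ L) (A.noodle I es) (Ls.drop i) := by
  induction es generalizing p I i with
  | nil =>
    have hi : i < Ls.length := by simp only [List.length_nil] at hl; omega
    have hF : ∀ q ∈ A.aut.accept, lev q = i := fun q hq => by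
      have := hA.accept q hq
      simp only [List.length_nil] at hl
      omega
    rw [List.drop_eq_getElem_cons hi,
      List.drop_eq_nil_of_le (by simp only [List.length_nil] at hl; omega)]
    refine .cons ⟨hA.epsFree_trim (fun q hq => (hI q hq).1) hF, fun w hw => ?_⟩ .nil
    obtain ⟨p', hp', q, hq, hr⟩ := mem_lang_trim_withEnds.1 hw
    exact hA.mem i hi p' q w (hI p' hp').1 (hF q hq) (hI p' hp').2 (.inl hq) hr
  | cons e es ih =>
    obtain ⟨q, r⟩ := e
    have hlt := hA.lev_add_length_lt h.2.2
    obtain ⟨h, hr, ht⟩ := h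
    obtain ⟨w, h⟩ := exists_isPath_iff.1 h
    have hle := hA.le_of_run h
    have hlr := hA.eps _ _ hr
    have hlp := (hI p hp).1
    simp only [List.length_cons] at hl
    have hi : i < Ls.length := by omega
    have hlq : lev q = i := by omega
    rw [List.drop_eq_getElem_cons hi]
    refine .cons ⟨hA.epsFree_trim (fun q hq => (hI q hq).1) (by rintro _ rfl; exact hlq),
      fun w hw => ?_⟩ (ih ht (I := {r}) rfl (i := i + 1) ?_ (by omega))
    · obtain ⟨p', hp', _, rfl, hr'⟩ := mem_lang_trim_withEnds.1 hw
      exact hA.mem i hi p' _ w (hI p' hp').1 hlq (hI p' hp').2 (.inr ⟨r, hr⟩) hr'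
    · rintro _ rfl
      exact ⟨by omega, .inr ⟨q, hr⟩⟩

theorem Layered.noodlify (hA : A.Layered lev Ls) {N : List (FinAut α)}
    (hN : N ∈ A.noodlify Ls.length) :
    List.Forall₂ (fun N L => EpsFree N ∧ lang N ≤ L) N Ls := by
  obtain ⟨es, hl, ⟨p, hp, ht⟩, rfl⟩ := hN
  have := hA.noodle ht hp (i := 0) (fun q hq => ⟨hA.start q hq, .inl hq⟩) (by omega)
  rwa [List.drop_zero] at this

end

end FinAut

namespace AutAssign

open FinAut

variable {α X : Type*} {A : AutAssign α X}

/-! ### Automata of terms -/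

theorem mem_lang_ofTerm {s : Term X} {w : List α} :
    w ∈ (A.ofTerm s).lang ↔
      ∃ ws, List.Forall₂ (fun x w => w ∈ (A x).lang) s ws ∧ ws.flatten = w := by
  induction s generalizing w with
  | nil =>
    rw [ofTerm, mem_lang_unit]
    constructor
    · rintro rfl
      exact ⟨[], .nil, rfl⟩
    · rintro ⟨_, h, rfl⟩
      cases h
      rfl
  | cons x s ih =>
    have key : w ∈ (A.ofTerm (x :: s)).lang ↔
        ∃ u ∈ (A x).lang, ∃ u' ∈ (A.ofTerm s).lang, u ++ u' = w := by
      cases s with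
      | nil =>
        simp only [ofTerm, mem_lang_unit, exists_eq_left, List.append_nil, exists_eq_right]
      | cons y t => exact mem_lang_concat
    rw [key]
    constructor
    · rintro ⟨u, hu, u', hu', rfl⟩
      obtain ⟨ws, hws, rfl⟩ := ih.1 hu'
      exact ⟨u :: ws, .cons hu hws, rfl⟩
    · rintro ⟨_, h, rfl⟩
      obtain ⟨u, ws, hu, hws, rfl⟩ := List.forall₂_cons_left_iff.1 h
      exact ⟨u, hu, _, ih.2 ⟨ws, hws, rfl⟩, rfl⟩

theorem termValue_mem_lang_ofTerm {ν : X → List α} {s : Term X} (h : ∀ x ∈ s, ν x ∈ (A x).lang) :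
    termValue ν s ∈ (A.ofTerm s).lang :=
  mem_lang_ofTerm.2 ⟨s.map ν, List.forall₂_map_right_iff.2 (List.forall₂_same.2 h),
    List.flatMap_def.symm⟩

theorem lang_ofTerm_mono {A' : AutAssign α X} {s : Term X}
    (h : ∀ x ∈ s, (A' x).lang ≤ (A x).lang) : (A'.ofTerm s).lang ≤ (A.ofTerm s).lang := by
  intro w hw
  obtain ⟨ws, hws, rfl⟩ := mem_lang_ofTerm.1 hw
  refine mem_lang_ofTerm.2 ⟨ws, ?_, rfl⟩
  rw [List.forall₂_iff_zip] at hws ⊢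
  exact ⟨hws.1, fun {x _} hx => h x (List.of_mem_zip hx).1 (hws.2 hx)⟩

theorem exists_splitRun_ofTerm {ν : X → List α} {s : Term X} (hs : s ≠ [])
    (h : ∀ x ∈ s, ν x ∈ (A x).lang) :
    ∃ p ∈ (A.ofTerm s).aut.start, (A.ofTerm s).SplitRun p (s.map ν) := by
  induction s with
  | nil => exact absurd rfl hs
  | cons x s ih =>
    rw [List.forall_mem_cons] at h
    obtain ⟨p, hp, q, hq, hr⟩ := mem_lang.1 h.1
    cases s with
    | nil => exact ⟨p, hp, .last hr hq⟩
    | cons y t =>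
      obtain ⟨p', hp', hr'⟩ := ih (List.cons_ne_nil _ _) h.2
      exact ⟨Sum.inl p, ⟨p, hp, rfl⟩, .cons hr.concat_inl (inr_mem_concat_step hq hp')
        hr'.concat_inr⟩

theorem exists_layered_ofTerm {s : Term X} (hs : s ≠ []) (h : ∀ x, (A x).EpsFree) :
    ∃ lev, (A.ofTerm s).Layered lev (s.map fun x => (A x).lang) := by
  induction s with
  | nil => exact absurd rfl hs
  | cons x s ih =>
    cases s with
    | nil => exact ⟨_, layered_singleton (h x)⟩
    | cons y t =>
      obtain ⟨lev, hl⟩ := ih (List.cons_ne_nil _ _)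
      exact ⟨_, hl.concat (h x)⟩

/-! ### Refinement -/

open Classical in
/-- The automata of a noodle whose intersection is assigned to `x`: those at the occurrences of `x`
in the term. -/
theorem unify_cases {s : Term X} {N : List (FinAut α)} (hl : s.length = N.length) (x : X) :
    (x ∉ s ∧ A.unify s N x = A x) ∨
      (x ∈ s ∧ ∃ B L, A.unify s N x = L.foldl FinAut.inter B ∧
        ∀ C, C ∈ B :: L ↔ (x, C) ∈ s.zip N) := by
  have key : ∀ C, C ∈ (s.zip N).filterMap (fun p => if p.1 = x then some p.2 else none) ↔
      (x, C) ∈ s.zip N := by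
    intro C
    rw [List.mem_filterMap]
    constructor
    · rintro ⟨⟨y, D⟩, hm, h⟩
      dsimp only at h
      split_ifs at h with hy
      cases h
      exact hy ▸ hm
    · exact fun h => ⟨(x, C), h, if_pos rfl⟩
  have hx : x ∈ s ↔ ∃ C, (x, C) ∈ s.zip N := by
    conv_lhs => rw [← List.map_fst_zip hl.le]
    simp
  rw [hx, unify]
  simp only [← key]
  cases (s.zip N).filterMap (fun p => if p.1 = x then some p.2 else none) with
  | nil => exact .inl ⟨by simp, rfl⟩
  | cons B L => exact .inr ⟨⟨B, List.mem_cons_self⟩, B, L, rfl, fun _ => Iff.rfl⟩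

variable {A' : AutAssign α X} {B : FinAut α} {s t : Term X}

/-- What a refinement step guarantees: the languages only shrink, the one of the term to within that
of the right-hand side, and no language becomes empty. -/
structure IsRefinement (A A' : AutAssign α X) (s t : Term X) : Prop where
  epsFree : ∀ x, (A' x).EpsFree
  le : ∀ x, (A' x).lang ≤ (A x).lang
  eq_of_notMem : ∀ x ∉ s, A' x = A x
  nonempty : ∀ x ∈ s, ∃ w, w ∈ (A' x).lang
  incl : (A'.ofTerm s).lang ≤ (A.ofTerm t).lang

theorem isRefinement_of_mem_refinements (hA : ∀ x, (A x).EpsFree)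
    (hB : B.IsReductionOf (A.ofTerm t)) (h : A' ∈ A.refinements s B) :
    A.IsRefinement A' s t := by
  obtain ⟨⟨N, hN, rfl⟩, w, hw⟩ := h
  have hl := noodlify_length hN
  have hs : s ≠ [] := by
    rintro rfl
    obtain ⟨es, h, -⟩ := hN
    exact Nat.succ_ne_zero _ h
  obtain ⟨lev, hlev⟩ := exists_layered_ofTerm hs hA
  have hlay := (hlev.inter hB.1).noodlify (N := N) (by rwa [List.length_map])
  rw [List.forall₂_map_right_iff] at hlay
  have hpart : ∀ x C, (x, C) ∈ s.zip N → C.EpsFree ∧ C.lang ≤ (A x).lang := fun x C hx =>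
    List.forall₂_zip hlay.flip hx
  have hsub : ∀ x C, (x, C) ∈ s.zip N → (A.unify s N x).lang ≤ C.lang := by
    intro x C hx w hw
    obtain ⟨h, -⟩ | ⟨-, B, L, h, hm⟩ := unify_cases hl.symm x (A := A)
    · exact absurd (List.of_mem_zip hx).1 h
    · rw [h] at hw
      exact (mem_lang_foldl_inter L).1 hw C ((hm C).2 hx)
  constructor
  · intro x
    obtain ⟨-, h⟩ | ⟨-, B, L, h, hm⟩ := unify_cases hl.symm x (A := A)
    · rw [h]; exact hA x
    · rw [h]; exact EpsFree.foldl_inter fun C hC => (hpart x C ((hm C).1 hC)).1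
  · intro x
    obtain ⟨-, h⟩ | ⟨-, B, L, h, hm⟩ := unify_cases hl.symm x (A := A)
    · rw [h]
    · have hx := (hm B).1 List.mem_cons_self
      exact (hsub x B hx).trans (hpart x B hx).2
  · intro x hx
    obtain ⟨-, h⟩ | ⟨h, -⟩ := unify_cases hl.symm x (A := A)
    · exact h
    · exact absurd h hx
  · intro x hx
    obtain ⟨ws, hws, -⟩ := mem_lang_ofTerm.1 hw
    obtain ⟨i, hi, rfl⟩ := List.getElem_of_mem hx
    exact ⟨_, hws.get hi (hws.length_eq ▸ hi)⟩
  · intro w hw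
    obtain ⟨ws, hws, rfl⟩ := mem_lang_ofTerm.1 hw
    have hflat := flatten_mem_lang_of_noodlify hN (ws := ws) <| by
      rw [List.forall₂_iff_get] at hws ⊢
      refine ⟨hws.1.symm.trans hl.symm, fun i hi hi' => ?_⟩
      have his : i < s.length := hl ▸ hi'
      refine hsub (s.get ⟨i, his⟩) _ ?_ (hws.2 i his hi)
      have hz : i < (s.zip N).length := by rw [List.length_zip]; omega
      have : (s.zip N)[i] = (s.get ⟨i, his⟩, N.get ⟨i, hi'⟩) := List.getElem_zip
      exact this ▸ List.getElem_mem hz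
    exact hB.2 ▸ (mem_lang_inter.1 hflat).2

/-- No solution of the equation is lost in a refinement step: the run of the product automaton on
the value of the equation can be cut where the values of the variables end. -/
theorem exists_mem_refinements (hB : B.IsReductionOf (A.ofTerm t)) (hs : s ≠ []) {ν : X → List α}
    (hν : ∀ x, ν x ∈ (A x).lang) (hst : termValue ν s = termValue ν t) :
    ∃ A' ∈ A.refinements s B, ∀ x, ν x ∈ (A' x).lang := by
  obtain ⟨p, hp, hrun⟩ := exists_splitRun_ofTerm hs fun x _ => hν x
  have hBt : termValue ν s ∈ B.lang := by
    rw [hst, hB.2]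
    exact termValue_mem_lang_ofTerm fun x _ => hν x
  obtain ⟨q, hq, f, hf, hBr⟩ := mem_lang.1 hBt
  obtain ⟨N, hN, hw⟩ := (hrun.inter hf (q := q)
    (by rwa [← List.flatMap_def])).exists_mem_noodlify ⟨hp, hq⟩
  rw [List.length_map] at hN
  rw [List.forall₂_map_left_iff] at hw
  have hν' : ∀ x, ν x ∈ (A.unify s N x).lang := by
    intro x
    obtain ⟨-, h⟩ | ⟨-, B, L, h, hm⟩ := unify_cases (noodlify_length hN).symm x (A := A)
    · rw [h]; exact hν x
    · rw [h, mem_lang_foldl_inter]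
      exact fun C hC => List.forall₂_zip hw ((hm C).1 hC)
  exact ⟨_, ⟨⟨N, hN, rfl⟩, _, termValue_mem_lang_ofTerm fun x _ => hν' x⟩, hν'⟩

end AutAssign

/-! ### Solutions from stable inclusion graphs -/

section Shortlex

variable {α : Type*} {r : α → α → Prop}

theorem shortlex_append_of_shortlex {a a' b b' : List α} (ha : List.Shortlex r a a')
    (hb : b.length ≤ b'.length) : List.Shortlex r (a ++ b) (a' ++ b') := by
  rw [List.shortlex_def] at ha ⊢
  simp only [List.length_append]
  have lex : ∀ {a a' : List α}, a.length = a'.length → List.Lex r a a' →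
      List.Lex r (a ++ b) (a' ++ b') := by
    intro a a' hl h
    induction h with
    | nil => cases hl
    | cons _ ih => exact .cons (ih (Nat.succ.inj hl))
    | rel h => exact .rel h
  obtain h | ⟨h, h'⟩ := ha
  · exact .inl (by omega)
  · obtain hb | hb := hb.lt_or_eq
    · exact .inl (by omega)
    · exact .inr ⟨by omega, lex h h'⟩

theorem length_le_of_not_shortlex {a b : List α} (h : ¬ List.Shortlex r b a) :
    a.length ≤ b.length :=
  not_lt.1 fun h' => h (.of_length_lt h')

theorem not_shortlex_append [Std.Trichotomous r] [Std.Asymm r] {a a' b b' : List α}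
    (ha : ¬ List.Shortlex r a' a) (hb : ¬ List.Shortlex r b' b) :
    ¬ List.Shortlex r (a' ++ b') (a ++ b) := by
  have key : a ++ b = a' ++ b' ∨ List.Shortlex r (a ++ b) (a' ++ b') := by
    obtain h | rfl | h := trichotomous_of (List.Shortlex r) a a'
    · exact .inr (shortlex_append_of_shortlex h (length_le_of_not_shortlex hb))
    · obtain h | rfl | h := trichotomous_of (List.Shortlex r) b b'
      · exact .inr (h.append_left a)
      · exact .inl rfl
      · exact absurd h hb
    · exact absurd h ha
  obtain h | h := key
  · rw [h]; exact irrefl _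
  · exact asymm h

end Shortlex

section Stable

open AutAssign

variable {α X : Type*} {A : AutAssign α X}

/-- Assigning to each variable the shortlex-least word of its language solves all equations whose
two sides have the same language: the value of a term is then the shortlex-least word of its
language. -/
theorem exists_least_assignment (hne : ∀ x, ∃ w, w ∈ (A x).lang) :
    ∃ ν : X → List α, (∀ x, ν x ∈ (A x).lang) ∧
      ∀ s t : Term X, (A.ofTerm s).lang = (A.ofTerm t).lang → termValue ν s = termValue ν t := by
  have wf : WellFounded (List.Shortlex (WellOrderingRel (α := α))) :=
    List.Shortlex.wf WellOrderingRel.isWellOrder.wf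
  choose ν hν hmin using fun x => wf.has_min {w | w ∈ (A x).lang} (hne x)
  have key : ∀ (s : Term X), ∀ w ∈ (A.ofTerm s).lang,
      ¬ List.Shortlex WellOrderingRel w (termValue ν s) := by
    intro s w hw
    obtain ⟨ws, hws, rfl⟩ := mem_lang_ofTerm.1 hw
    clear hw
    induction hws with
    | nil => exact irrefl _
    | cons h _ ih => exact not_shortlex_append (hmin _ _ h) ih
  refine ⟨ν, hν, fun s t h => ?_⟩
  have hs := termValue_mem_lang_ofTerm (s := s) fun x _ => hν x
  have ht := termValue_mem_lang_ofTerm (s := t) fun x _ => hν x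
  obtain h' | h' | h' := trichotomous_of (List.Shortlex (WellOrderingRel (α := α)))
    (termValue ν s) (termValue ν t)
  · exact absurd h' (key t _ (h ▸ hs))
  · exact h'
  · exact absurd h' (key s _ (h ▸ ht))

theorem termValue_congr {ν ν' : X → List α} {s : Term X} (h : ∀ x ∈ s, ν x = ν' x) :
    termValue ν s = termValue ν' s := by
  rw [termValue, termValue, List.flatMap_def, List.flatMap_def, List.map_congr_left h]

/-- In a term without repeated variables, the variables can be given values independently of one
another. -/
theorem exists_termValue_eq (hne : ∀ x, ∃ w, w ∈ (A x).lang) {t : Term X} (ht : t.Nodup)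
    {w : List α} (hw : w ∈ (A.ofTerm t).lang) :
    ∃ ν : X → List α, (∀ x, ν x ∈ (A x).lang) ∧ termValue ν t = w := by
  classical
  obtain ⟨ws, hws, rfl⟩ := mem_lang_ofTerm.1 hw
  clear hw
  induction hws with
  | nil =>
    choose ν hν using hne
    exact ⟨ν, hν, rfl⟩
  | @cons x w t ws h _ ih =>
    rw [List.nodup_cons] at ht
    obtain ⟨ν, hν, h'⟩ := ih ht.2
    refine ⟨Function.update ν x w, fun y => ?_, ?_⟩
    · obtain rfl | hy := eq_or_ne y x
      · rwa [Function.update_self]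
      · rw [Function.update_of_ne hy]
        exact hν y
    · have : termValue (Function.update ν x w) t = ws.flatten := by
        rw [← h']
        exact termValue_congr fun y hy => Function.update_of_ne (ne_of_mem_of_not_mem hy ht.1) _ _
      rw [termValue] at this ⊢
      rw [List.flatMap_cons, Function.update_self, this, List.flatten_cons]

namespace InclGraph

variable {G : InclGraph X} {eqs : Finset (Sym2 (Term X))}

/-- A vertex whose dual is not a vertex. -/
def Single (G : InclGraph X) (v : Vertex X) : Prop := v ∈ G.verts ∧ v.swap ∉ G.verts

open Classical in
theorem Single.sum_count_le (hG : G.IsInclusionGraphOf eqs) {v : Vertex X} (hv : G.Single v)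
    {x : X} (hx : x ∈ v.2) :
    ∑ u ∈ G.verts, u.2.count x ≤ 1 := by
  by_contra h
  exact hv.2 (hG.multi_occur v.1 v.2 hv.1 ⟨x, hx, not_le.1 h⟩)

open Classical in
theorem Single.nodup (hG : G.IsInclusionGraphOf eqs) {v : Vertex X} (hv : G.Single v) :
    v.2.Nodup := by
  rw [List.nodup_iff_count_le_one]
  intro x
  by_cases hx : x ∈ v.2
  · exact (Finset.single_le_sum (f := fun u : Vertex X => u.2.count x)
      (fun _ _ => Nat.zero_le _) hv.1).trans (hv.sum_count_le hG hx)
  · rw [List.count_eq_zero_of_not_mem hx]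
    exact Nat.zero_le _

open Classical in
theorem Single.eq_of_mem (hG : G.IsInclusionGraphOf eqs) {v u : Vertex X} (hv : G.Single v)
    (hu : u ∈ G.verts) {x : X} (hx : x ∈ v.2) (hxu : x ∈ u.2) : u = v := by
  by_contra hne
  have h1 := hv.sum_count_le hG hx
  have h2 : ∑ w ∈ {u, v}, w.2.count x ≤ ∑ w ∈ G.verts, w.2.count x :=
    Finset.sum_le_sum_of_subset (by
      intro w hw
      rw [Finset.mem_insert, Finset.mem_singleton] at hw
      obtain rfl | rfl := hw
      exacts [hu, hv.1])
  rw [Finset.sum_pair hne] at h2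
  have h3 := List.count_pos_iff.2 hx
  have h4 := List.count_pos_iff.2 hxu
  omega

/-- Vertices without dual lie on no cycle, so they can be ranked along the edges. -/
theorem exists_rank (hG : G.IsInclusionGraphOf eqs) :
    ∃ rank : Vertex X → ℕ, ∀ v w, G.Single w → G.edge v w → rank w < rank v := by
  classical
  refine ⟨fun v => (G.verts.filter fun w => Relation.TransGen G.edge v w).card,
    fun v w hw h => Finset.card_lt_card ?_⟩
  rw [Finset.ssubset_iff_of_subset
    (Finset.monotone_filter_right _ fun u _ hu => Relation.TransGen.head h hu)]
  exact ⟨w, Finset.mem_filter.2 ⟨hw.1, .single h⟩, fun hc =>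
    hw.2 (hG.cycle w.1 w.2 hw.1 (Finset.mem_filter.1 hc).2)⟩

/-- If all inclusions of an inclusion graph hold and no language is empty, then the equations have a
solution in the languages. -/
theorem IsInclusionGraphOf.exists_solution (hG : G.IsInclusionGraphOf eqs)
    (hne : ∀ x, ∃ w, w ∈ (A x).lang)
    (hincl : ∀ v ∈ G.verts, (A.ofTerm v.1).lang ≤ (A.ofTerm v.2).lang) :
    ∃ ν : X → List α, (∀ s t : Term X, s(s, t) ∈ eqs → termValue ν s = termValue ν t) ∧
      ∀ x, ν x ∈ (A x).lang := by
  classical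
  obtain ⟨ν₀, hν₀, hleast⟩ := exists_least_assignment hne
  obtain ⟨rank, hrank⟩ := exists_rank hG
  -- the single vertices are satisfied in the order of their ranks, each by a choice of values for
  -- the variables of its right-hand side, which no vertex of at most the same rank depends on
  have main : ∀ n, ∃ ν : X → List α, (∀ x, ν x ∈ (A x).lang) ∧
      (∀ x, (∀ v, G.Single v → x ∉ v.2) → ν x = ν₀ x) ∧
      ∀ v, G.Single v → rank v < n → termValue ν v.1 = termValue ν v.2 := by
    intro n
    induction n with
    | zero => exact ⟨ν₀, hν₀, fun _ _ => rfl, fun v _ h => absurd h (Nat.not_lt_zero _)⟩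
    | succ n ih =>
      obtain ⟨ν, hν, hfix, heq⟩ := ih
      have hex : ∀ v, ∃ σ : X → List α, (∀ x, σ x ∈ (A x).lang) ∧
          (G.Single v → termValue σ v.2 = termValue ν v.1) := by
        intro v
        by_cases hv : G.Single v
        · obtain ⟨σ, h1, h2⟩ := exists_termValue_eq hne (hv.nodup hG)
            (hincl v hv.1 (termValue_mem_lang_ofTerm fun x _ => hν x))
          exact ⟨σ, h1, fun _ => h2⟩
        · exact ⟨ν, hν, fun h => absurd h hv⟩
      choose σ hσ hσv using hex
      let ν' : X → List α := fun x =>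
        if h : ∃ v, G.Single v ∧ rank v = n ∧ x ∈ v.2 then σ h.choose x else ν x
      have hnew : ∀ v, G.Single v → rank v = n → ∀ x ∈ v.2, ν' x = σ v x := by
        intro v hv hr x hx
        have h : ∃ v, G.Single v ∧ rank v = n ∧ x ∈ v.2 := ⟨v, hv, hr, hx⟩
        simp only [ν', dif_pos h]
        rw [Single.eq_of_mem hG hv h.choose_spec.1.1 hx h.choose_spec.2.2]
      have hold : ∀ x, (∀ v, G.Single v → x ∈ v.2 → rank v ≠ n) → ν' x = ν x := fun x h =>
        dif_neg fun ⟨v, hv, hr, hx⟩ => h v hv hx hr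
      have hleft : ∀ v, G.Single v → rank v ≤ n → termValue ν' v.1 = termValue ν v.1 :=
        fun v hv hr => termValue_congr fun x hx => hold x fun w hw hxw =>
          ((hrank v w hw ((hG.edges v w).2 ⟨hv.1, hw.1, x, hx, hxw⟩)).trans_le hr).ne
      refine ⟨ν', fun x => ?_, fun x hx => ?_, fun v hv hr => ?_⟩
      · simp only [ν']
        split_ifs
        exacts [hσ _ x, hν x]
      · rw [hold x fun v hv h => absurd h (hx v hv), hfix x hx]
      · rw [hleft v hv (Nat.le_of_lt_succ hr)]
        obtain hr | hr := (Nat.le_of_lt_succ hr).lt_or_eq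
        · rw [heq v hv hr]
          refine (termValue_congr fun x hx => hold x fun w hw hxw => ?_).symm
          rw [Single.eq_of_mem hG hv hw.1 hx hxw]
          exact hr.ne
        · rw [termValue_congr (hnew v hv hr), hσv v hv]
  obtain ⟨ν, hν, hfix, heq⟩ := main (G.verts.sup rank + 1)
  refine ⟨ν, ?_, hν⟩
  have hvert : ∀ v ∈ G.verts, termValue ν v.1 = termValue ν v.2 := by
    intro v hv
    by_cases hd : v.swap ∈ G.verts
    · -- no variable of a vertex with dual occurs on the right-hand side of a single vertex
      have hsing : ∀ u ∈ G.verts, u.swap ∈ G.verts → ∀ x ∈ u.2, ν x = ν₀ x := by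
        refine fun u hu hu' x hx => hfix x fun w hw hxw => hw.2 ?_
        rwa [← Single.eq_of_mem hG hw hu hxw hx]
      have hl : termValue ν v.1 = termValue ν₀ v.1 := termValue_congr (hsing v.swap hd hv)
      rw [hl, termValue_congr (hsing v hv hd)]
      exact hleast _ _ (le_antisymm (hincl v hv) (hincl _ hd))
    · exact heq v ⟨hv, hd⟩ (Nat.lt_succ_of_le (Finset.le_sup hv))
  intro s t h
  obtain h | h := hG.at_least_one s t h
  · exact hvert _ h
  · exact (hvert _ h).symm

end InclGraph

end Stable

/-! ### Invariants of the main loop -/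

section Loop

variable {α X : Type*} {G : InclGraph X}

/-- The invariant of a branch of the search, where `L` gives the regular constraints: the automata
are ε-free, nonempty and within the constraints, and every inclusion that fails is queued. -/
structure BranchInvariant (G : InclGraph X) (L : X → Language α) (A : AutAssign α X)
    (W : List (Vertex X)) : Prop where
  epsFree : ∀ x, (A x).EpsFree
  nonempty : ∀ x, ∃ w, w ∈ (A x).lang
  le : ∀ x, (A x).lang ≤ L x
  verts : ∀ v ∈ W, v ∈ G.verts
  incl : ∀ v ∈ G.verts, v ∉ W → (A.ofTerm v.1).lang ≤ (A.ofTerm v.2).lang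

theorem BranchInvariant.skip {L : X → Language α} {A : AutAssign α X} {v : Vertex X}
    {W : List (Vertex X)} (h : BranchInvariant G L A (v :: W))
    (hv : (A.ofTerm v.1).lang ≤ (A.ofTerm v.2).lang) : BranchInvariant G L A W where
  epsFree := h.epsFree
  nonempty := h.nonempty
  le := h.le
  verts u hu := h.verts u (List.mem_cons_of_mem _ hu)
  incl u hu huW := by
    obtain rfl | hne := eq_or_ne u v
    · exact hv
    · exact h.incl u hu (by simp [hne, huW])

/-- A refinement at `v` can only break inclusions whose right-hand side shares a variable with the
left-hand side of `v`, and these are the successors of `v`. -/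
theorem BranchInvariant.branch {eqs : Finset (Sym2 (Term X))} (hG : G.IsInclusionGraphOf eqs)
    {L : X → Language α} {A A' : AutAssign α X} {v : Vertex X} {W U : List (Vertex X)}
    (h : BranchInvariant G L A (v :: W)) (hA' : A.IsRefinement A' v.1 v.2)
    (hU : ∀ u, u ∈ U ↔ G.edge v u ∧ u ∉ W) : BranchInvariant G L A' (W ++ U) where
  epsFree := hA'.epsFree
  nonempty x := by
    by_cases hx : x ∈ v.1
    · exact hA'.nonempty x hx
    · rw [hA'.eq_of_notMem x hx]
      exact h.nonempty x
  le x := (hA'.le x).trans (h.le x)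
  verts u hu := by
    obtain hu | hu := List.mem_append.1 hu
    · exact h.verts u (List.mem_cons_of_mem _ hu)
    · exact ((hG.edges v u).1 ((hU u).1 hu).1).2.1
  incl u hu huW := by
    rw [List.mem_append, hU, not_or, not_and_not_right] at huW
    have hx : ∀ x ∈ u.2, x ∉ v.1 := fun x hxu hxv =>
      huW.1 (huW.2 ((hG.edges v u).2 ⟨h.verts v List.mem_cons_self, hu, x, hxv, hxu⟩))
    refine le_trans ?_ (AutAssign.lang_ofTerm_mono (A := A') (A' := A) fun x hxu => by
      rw [hA'.eq_of_notMem x (hx x hxu)])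
    obtain rfl | hne := eq_or_ne u v
    · exact hA'.incl
    · exact (AutAssign.lang_ofTerm_mono fun x _ => hA'.le x).trans
        (h.incl u hu (by simp [hne, huW.1]))

theorem Step.branchInvariant {eqs : Finset (Sym2 (Term X))} (hG : G.IsInclusionGraphOf eqs)
    {L : X → Language α} {Q Q' : Worklist α X} (h : Step G Q Q')
    (hQ : ∀ b ∈ Q, BranchInvariant G L b.1 b.2) : ∀ b ∈ Q', BranchInvariant G L b.1 b.2 := by
  cases h with
  | skip A v W Q hincl =>
    rw [List.forall_mem_cons] at hQ
    rw [List.forall_mem_append, List.forall_mem_singleton]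
    exact ⟨hQ.2, hQ.1.skip hincl⟩
  | branch A v W Q hincl R hR U hU T hT =>
    rw [List.forall_mem_cons] at hQ
    rw [List.forall_mem_append, List.forall_mem_map]
    refine ⟨hQ.2, fun A' hA' => ?_⟩
    obtain ⟨B, hB, rfl⟩ := hR
    exact hQ.1.branch hG
      (AutAssign.isRefinement_of_mem_refinements hQ.1.epsFree hB ((hT.2 A').1 hA')) hU.2

/-- Each step of the loop keeps a branch that admits a given solution of the equations. -/
theorem Step.exists_branch {Q Q' : Worklist α X} (h : Step G Q Q') {ν : X → List α}
    (hν : ∀ v ∈ G.verts, termValue ν v.1 = termValue ν v.2)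
    (hE : ∀ v u, G.edge v u → u ∈ G.verts)
    (hQ : ∃ b ∈ Q, (∀ v ∈ b.2, v ∈ G.verts) ∧ ∀ x, ν x ∈ (b.1 x).lang) :
    ∃ b ∈ Q', (∀ v ∈ b.2, v ∈ G.verts) ∧ ∀ x, ν x ∈ (b.1 x).lang := by
  obtain ⟨b, hb, hW, hsol⟩ := hQ
  cases h with
  | skip A v W Q hincl =>
    obtain rfl | hb := List.mem_cons.1 hb
    · exact ⟨(A, W), by simp, fun u hu => hW u (List.mem_cons_of_mem _ hu), hsol⟩
    · exact ⟨b, List.mem_append_left _ hb, hW, hsol⟩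
  | branch A v W Q hincl R hR U hU T hT =>
    obtain rfl | hb := List.mem_cons.1 hb
    · obtain ⟨B, hB, rfl⟩ := hR
      have hv := hν v (hW v List.mem_cons_self)
      -- the empty term has no noodle, but for it the failed inclusion test excludes a solution
      have hs : v.1 ≠ [] := by
        intro hs
        refine hincl fun w hw => ?_
        have ht := AutAssign.termValue_mem_lang_ofTerm (s := v.2) fun x _ => hsol x
        rw [← hv, hs] at ht
        rw [hs] at hw
        rwa [FinAut.mem_lang_unit.1 hw]
      obtain ⟨A', hA', hsol'⟩ := AutAssign.exists_mem_refinements hB hs hsol hv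
      refine ⟨(A', W ++ U), List.mem_append_right _ (List.mem_map_of_mem ((hT.2 A').2 hA')), ?_,
        hsol'⟩
      intro u hu
      obtain hu | hu := List.mem_append.1 hu
      · exact hW u (List.mem_cons_of_mem _ hu)
      · exact hE v u ((hU.2 u).1 hu).1
    · exact ⟨b, List.mem_append_left _ hb, hW, hsol⟩

end Loop

end StringSolver

theorem theorem6 {α X : Type*} [Finite α] (Φ : StringSolver.StringSystem α X)
    (G : StringSolver.InclGraph X) (hG : G.IsInclusionGraphOf Φ.eqs)
    (A : StringSolver.AutAssign α X) (hA : A.Represents Φ.lang) :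
    (Φ.Feasible → StringSolver.Propagate G A StringSolver.Answer.sat → Φ.Satisfiable) ∧
      (StringSolver.Propagate G A StringSolver.Answer.unsat → ¬ Φ.Satisfiable) := by
  constructor
  · rintro hne (⟨V, hV, A', Q, h⟩ | _)
    have hinit : ∀ b ∈ [(A, V)], StringSolver.BranchInvariant G Φ.lang b.1 b.2 := by
      rw [List.forall_mem_singleton]
      exact
      { epsFree := fun x => (hA x).1
        nonempty := fun x => by rw [(hA x).2]; exact hne x
        le := fun x => (hA x).2.le
        verts := fun v hv => (hV.2 v).1 hv
        incl := fun v hv hv' => absurd ((hV.2 v).2 hv) hv' }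
    have hinv : ∀ Q, Relation.ReflTransGen (StringSolver.Step G) [(A, V)] Q →
        ∀ b ∈ Q, StringSolver.BranchInvariant G Φ.lang b.1 b.2 := by
      intro Q h
      induction h with
      | refl => exact hinit
      | tail _ hstep ih => exact hstep.branchInvariant hG ih
    have hA' := hinv _ h _ List.mem_cons_self
    obtain ⟨ν, hν, hmem⟩ := hG.exists_solution hA'.nonempty
      fun v hv => hA'.incl v hv List.not_mem_nil
    exact ⟨ν, hν, fun x => hA'.le x (hmem x)⟩
  · rintro (_ | ⟨V, hV, h⟩) ⟨ν, hν, hmem⟩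
    have key : ∀ Q, Relation.ReflTransGen (StringSolver.Step G) [(A, V)] Q →
        ∃ b ∈ Q, (∀ v ∈ b.2, v ∈ G.verts) ∧ ∀ x, ν x ∈ (b.1 x).lang := by
      intro Q h
      induction h with
      | refl =>
        exact ⟨(A, V), List.mem_singleton_self _, fun v hv => (hV.2 v).1 hv,
          fun x => by rw [(hA x).2]; exact hmem x⟩
      | tail _ hstep ih =>
        exact hstep.exists_branch (fun v hv => hν _ _ (hG.vertex_of_eq v.1 v.2 hv))
          (fun v u h => ((hG.edges v u).1 h).2.1) ih
    obtain ⟨b, hb, -⟩ := key [] h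
    exact absurd hb List.not_mem_nil
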